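/- A cross in $\mathbb{R}^5$ centered at $u$ is the union of the $11$ closed axis-parallel unit cubes centered at $u$ and at $u\pm e_i$, $1\le i\le 5$. Let $\mathcal{T}\subset\mathbb{Z}^5$ be a set containing the origin $O$ such that the crosses centered at the points of $\mathcal{T}$ form a $Z$-tiling of $\mathbb{R}^5$, i.e. these crosses cover $\mathbb{R}^5$ and the interiors of any two distinct ones are disjoint. The elements of $\mathcal{T}$ are called codewords. For $W\in\mathcal{T}$ and $k\in\mathbb{N}$ let $$N_k(W)=\Big\{V\in\mathcal{T} : \sum_{i=1}^{5}|W_i-V_i|\le k\Big\}.$$ Then: 1. for every $W\in\mathcal{T}$ we have $\{V-W : V\in N_5(W)\}=N_5(O)$, and $N_5(O)$ is centrally symmetric, that is, $V\in N_5(O)$ implies $-V\in N_5(O)$; 2. likewise for every $W\in\mathcal{T}$ we have $\{V-W : V\in N_3(W)\}=N_3(O)$, and $V\in N_3(O)$ implies $-V\in N_3(O)$. -/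

import Mathlib

namespace CrossTiling

/-- The closed axis-parallel unit cube of `ℝⁿ` centered at `c`. -/
def unitCube {n : ℕ} (c : Fin n → ℝ) : Set (Fin n → ℝ) :=
  {x | ∀ i, |x i - c i| ≤ 1 / 2}

/-- The `n`-dimensional cross centered at `u`: the central unit cube together with its `2n`
mirror images in its facets, whose centers are `u + e_i` and `u - e_i`. -/
def cross {n : ℕ} (u : Fin n → ℝ) : Set (Fin n → ℝ) :=
  unitCube u ∪ ⋃ i : Fin n, (unitCube (u + Pi.single i 1) ∪ unitCube (u - Pi.single i 1))

/-- The crosses centered at the points of `U` tile `ℝⁿ`: they cover the whole space, and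
distinct ones have disjoint interiors. -/
def IsTiling {n : ℕ} (U : Set (Fin n → ℝ)) : Prop :=
  (⋃ u ∈ U, cross u) = Set.univ ∧
    ∀ u ∈ U, ∀ v ∈ U, u ≠ v → Disjoint (interior (cross u)) (interior (cross v))

/-- A set `T ⊆ ℤⁿ` is (the set of centers of) a `Z`-tiling of `ℝⁿ` by crosses: the crosses
centered at the points of `T` tile `ℝⁿ`. -/
def IsZTiling {n : ℕ} (T : Set (Fin n → ℤ)) : Prop :=
  IsTiling ((fun (W : Fin n → ℤ) (i : Fin n) => (W i : ℝ)) '' T)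

/-- The Manhattan distance of two words of `ℤⁿ`. -/
def manhattanDist {n : ℕ} (V W : Fin n → ℤ) : ℤ :=
  ∑ i, |V i - W i|

/-- The `k`-neighborhood of `W`: the codewords at Manhattan distance at most `k` from `W`. -/
def neighborhood {n : ℕ} (T : Set (Fin n → ℤ)) (k : ℕ) (W : Fin n → ℤ) : Set (Fin n → ℤ) :=
  {V | V ∈ T ∧ manhattanDist W V ≤ (k : ℤ)}

/-- The `k`-neighborhood of `W`, translated so that `W` goes to the origin. -/
def translatedNeighborhood {n : ℕ} (T : Set (Fin n → ℤ)) (k : ℕ) (W : Fin n → ℤ) :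
    Set (Fin n → ℤ) :=
  (fun V => V - W) '' neighborhood T k W

end CrossTiling

open Finset

namespace CrossTiling

/-- Frobenius in the group algebra: the number of `q`-multiples of the tile meeting `S`, modulo `q`. -/
theorem natCast_card_smul_translates {G ι : Type*} [AddCommGroup G] [Fintype ι] {v : ι → G}
    {S : Set G} [DecidablePred (· ∈ S)] (h : ∀ x, ∃! i, x + v i ∈ S) (q : ℕ) [Fact q.Prime] (x : G) :
    ((#{i | x + q • v i ∈ S} : ℕ) : ZMod q) = (Fintype.card ι : ZMod q) ^ (q - 1) := by
  classical
  let f : G → ZMod q := fun g => if g ∈ S then 1 else 0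
  let A : AddMonoidAlgebra (ZMod q) G := ∑ i, AddMonoidAlgebra.single (v i) 1
  let aug : AddMonoidAlgebra (ZMod q) G →ₐ[ZMod q] ZMod q :=
    AddMonoidAlgebra.lift (ZMod q) (ZMod q) G 1
  let L : AddMonoidAlgebra (ZMod q) G →ₗ[ZMod q] ZMod q :=
    Finsupp.linearCombination (ZMod q) (fun g => f (x + g)) ∘ₗ
      (AddMonoidAlgebra.coeffLinearEquiv (ZMod q)).toLinearMap
  have hf : ∀ y, ∑ i, f (y + v i) = 1 := by
    intro y
    obtain ⟨i, hi, hu⟩ := h y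
    rw [Finset.sum_eq_single i]
    · simp [f, hi]
    · intro j _ hj
      simp only [f, if_neg fun hm => hj (hu j hm)]
    · simp
  have hL : ∀ g c, L (.single g c) = c * f (x + g) := fun g c => by simp [L]
  have hLA : ∀ P, L (P * A) = aug P := by
    intro P
    induction P using AddMonoidAlgebra.induction_linear with
    | zero => simp
    | add P Q hP hQ => rw [add_mul, map_add, map_add, hP, hQ]
    | single g c =>
      simp only [A, Finset.mul_sum, AddMonoidAlgebra.single_mul_single, map_sum, hL, mul_one,
        ← add_assoc]
      rw [← Finset.mul_sum, hf]
      simp [aug]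
  have hA : aug A = Fintype.card ι := by simp [A, aug]
  have : CharP (AddMonoidAlgebra (ZMod q) G) q := charP_of_injective_algebraMap'  (ZMod q) q
  have hpow : A ^ q = ∑ i, AddMonoidAlgebra.single (q • v i) 1 := by
    simp only [A, sum_pow_char, AddMonoidAlgebra.single_pow, one_pow]
  have key := hLA (A ^ (q - 1))
  rw [← pow_succ, Nat.sub_add_cancel (Fact.out : q.Prime).one_le, hpow, map_pow, hA] at key
  rw [← key]
  simp [hL, f]

theorem existsUnique_of_card_filter_eq_one {ι : Type*} [Fintype ι] {P : ι → Prop} [DecidablePred P]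
    (h : #{i | P i} = 1) : ∃! i, P i := by
  obtain ⟨i, hi⟩ := card_eq_one.1 h
  simp only [Finset.ext_iff, mem_filter, mem_univ, true_and, mem_singleton] at hi
  exact ⟨i, (hi i).2 rfl, fun j hj => (hi j).1 hj⟩

/-- A tiling by translates of a set of prime size is periodic. -/
theorem add_smul_mem_iff {G ι : Type*} [AddCommGroup G] [Fintype ι] {v : ι → G}
    {S : Set G} (h : ∀ x, ∃! i, x + v i ∈ S) (hp : (Fintype.card ι).Prime) (x : G) (i j : ι) :
    x + Fintype.card ι • v i ∈ S ↔ x + Fintype.card ι • v j ∈ S := by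
  classical
  have : Fact (Fintype.card ι).Prime := ⟨hp⟩
  have key := natCast_card_smul_translates h (Fintype.card ι) x
  rw [CharP.cast_eq_zero (ZMod (Fintype.card ι)) (Fintype.card ι), zero_pow (Nat.sub_ne_zero_of_lt hp.one_lt), ZMod.natCast_eq_zero_iff]
    at key
  suffices H : ∀ i j, x + Fintype.card ι • v i ∈ S → x + Fintype.card ι • v j ∈ S from
    ⟨H i j, H j i⟩
  intro i j hi
  have hpos : 0 < #{i | x + Fintype.card ι • v i ∈ S} := card_pos.2 ⟨i, by simpa using hi⟩
  have hfull := (card_eq_iff_eq_univ _).1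
    ((card_le_univ _).antisymm (Nat.le_of_dvd hpos key))
  simpa using Finset.ext_iff.1 hfull j

/-- In a finite group, a tile may be multiplied by any prime not dividing its size. -/
theorem existsUnique_add_smul_mem {G ι : Type*} [AddCommGroup G] [Fintype G] [Fintype ι]
    {v : ι → G} {S : Set G} (h : ∀ x, ∃! i, x + v i ∈ S) {q : ℕ} (hq : q.Prime)
    (hqc : ¬ q ∣ Fintype.card ι) (x : G) : ∃! i, x + q • v i ∈ S := by
  classical
  have : Fact q.Prime := ⟨hq⟩
  have hcount : ∀ w : ι → G, ∑ x, #{i | x + w i ∈ S} = Fintype.card ι * #{x | x ∈ S} := by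
    intro w
    simp only [card_filter]
    rw [sum_comm]
    refine (sum_congr rfl fun i _ => Equiv.sum_comp (Equiv.addRight (w i))
      fun y => if y ∈ S then 1 else 0).trans ?_
    simp
  have hone : ∀ x, #{i | x + v i ∈ S} = 1 := by
    intro x
    obtain ⟨i, hi, hu⟩ := h x
    exact card_eq_one.2 ⟨i, by ext j; simpa using ⟨hu j, fun e => e ▸ hi⟩⟩
  have hpos : ∀ x ∈ univ, 1 ≤ #{i | x + q • v i ∈ S} := by
    intro x _
    have key := natCast_card_smul_translates h q x
    rw [ZMod.pow_card_sub_one_eq_one (by rwa [Ne, ZMod.natCast_eq_zero_iff])] at key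
    rw [Nat.one_le_iff_ne_zero]
    intro h0
    simp [h0] at key
  have hsum : ∑ x : G, 1 = ∑ x, #{i | x + q • v i ∈ S} := by
    rw [hcount, ← hcount v]
    simp [hone]
  exact existsUnique_of_card_filter_eq_one ((sum_eq_sum_iff_of_le hpos).1 hsum x (mem_univ x)).symm
/-- A queen at height `y` attacks none of the queens listed, which stand `d`, `d + 1`, … columns
before it. -/
def queenCompatible (y : ℕ) : ℕ → List ℕ → Bool
  | _, [] => true
  | d, a :: l => y != a && (y + d) % 11 != a && (a + d) % 11 != y && queenCompatible y (d + 1) l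

/-- The values of `x ↦ x * m` modulo `11` for `x < k`, last value first. -/
def linearPrefix (k m : ℕ) : List ℕ := (List.range k).reverse.map fun x => x * m % 11

/-- Backtracking search: every extension of the placement `l` by `n` queens is linear. -/
def extensionsLinear : ℕ → List ℕ → Bool
  | 0, l => (List.range 11).any fun m => l == linearPrefix 11 m
  | n + 1, l => (List.range 11).all fun y => !queenCompatible y 1 l || extensionsLinear n (y :: l)

theorem extensionsLinear_zero : extensionsLinear 10 [0] = true := by decide +kernel

/-- The values of `s` on `0, …, k - 1`, last value first. -/
def valuePrefix (s : ℕ → ℕ) (k : ℕ) : List ℕ := (List.range k).reverse.map s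

theorem valuePrefix_succ (s : ℕ → ℕ) (k : ℕ) : valuePrefix s (k + 1) = s k :: valuePrefix s k := by
  simp [valuePrefix, List.range_succ]

/-- `s` places eleven pairwise non-attacking queens on the toroidal `11 × 11` board. -/
structure IsToroidalQueens (s : ℕ → ℕ) : Prop where
  lt : ∀ i < 11, s i < 11
  ne : ∀ i j, i < j → j < 11 → s j ≠ s i
  add : ∀ i j, i < j → j < 11 → (s j + (j - i)) % 11 ≠ s i
  sub : ∀ i j, i < j → j < 11 → (s i + (j - i)) % 11 ≠ s j

theorem IsToroidalQueens.compatible {s : ℕ → ℕ} (h : IsToroidalQueens s) (k : ℕ) :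
    ∀ d, 0 < d → k + d ≤ 11 → queenCompatible (s (k + d - 1)) d (valuePrefix s k) = true := by
  induction k with
  | zero => intro d _ _; simp [valuePrefix, queenCompatible]
  | succ k ih =>
    intro d hd hk
    have e : k + 1 + d - 1 = k + d := by omega
    have e' : k + (d + 1) - 1 = k + d := by omega
    have e'' : k + d - k = d := by omega
    have h1 := h.ne k (k + d) (by omega) (by omega)
    have h2 := h.add k (k + d) (by omega) (by omega)
    have h3 := h.sub k (k + d) (by omega) (by omega)
    have h4 := ih (d + 1) (by omega) (by omega)
    rw [e'] at h4
    rw [e''] at h2 h3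
    rw [valuePrefix_succ, e]
    simp [queenCompatible, h1, h2, h3, h4]

theorem IsToroidalQueens.exists_linear_of_extensionsLinear {s : ℕ → ℕ} (h : IsToroidalQueens s)
    (n : ℕ) : ∀ k, n + k = 11 → extensionsLinear n (valuePrefix s k) = true →
      ∃ m, valuePrefix s 11 = linearPrefix 11 m := by
  induction n with
  | zero =>
    intro k hk hl
    obtain rfl : k = 11 := by omega
    rw [extensionsLinear, List.any_eq_true] at hl
    obtain ⟨m, -, hm⟩ := hl
    exact ⟨m, by simpa using hm⟩
  | succ n ih =>
    intro k hk hl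
    rw [extensionsLinear, List.all_eq_true] at hl
    have h1 := hl (s k) (List.mem_range.2 (h.lt k (by omega)))
    have h2 := h.compatible k 1 one_pos (by omega)
    rw [Nat.add_sub_cancel] at h2
    rw [h2, Bool.not_true, Bool.false_or, ← valuePrefix_succ] at h1
    exact ih (k + 1) (by omega) h1

theorem IsToroidalQueens.exists_linear {s : ℕ → ℕ} (h : IsToroidalQueens s) (h0 : s 0 = 0) :
    ∃ m, ∀ x < 11, s x = x * m % 11 := by
  obtain ⟨m, hm⟩ := h.exists_linear_of_extensionsLinear 10 1 rfl (by
    simpa [valuePrefix, h0] using extensionsLinear_zero)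
  refine ⟨m, fun x hx => ?_⟩
  rw [valuePrefix, linearPrefix, List.map_inj_left] at hm
  exact hm x (by simpa using hx)

/-- Toroidal `11`-queens placements are affine. -/
theorem exists_affine_of_queens (σ : ZMod 11 → ZMod 11)
    (h : ∀ a b, a ≠ b → σ a ≠ σ b ∧ σ a + a ≠ σ b + b ∧ σ a - a ≠ σ b - b) :
    ∃ m, ∀ a, σ a = σ 0 + a * m := by
  have inj : ∀ i j : ℕ, i < j → j < 11 → (j : ZMod 11) ≠ i := by
    intro i j hij hj e
    rw [ZMod.natCast_eq_natCast_iff', Nat.mod_eq_of_lt hj, Nat.mod_eq_of_lt (hij.trans hj)] at e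
    omega
  have hs : ∀ i : ℕ, (((σ i - σ 0).val : ℕ) : ZMod 11) = σ i - σ 0 := fun i => by simp
  have hq : IsToroidalQueens fun i => (σ i - σ 0).val := by
    refine ⟨fun i _ => ZMod.val_lt _, fun i j hij hj e => ?_, fun i j hij hj e => ?_,
      fun i j hij hj e => ?_⟩
    · exact (h _ _ (inj i j hij hj)).1 (by simpa using ZMod.val_injective 11 e)
    · have e' := congrArg (Nat.cast : ℕ → ZMod 11) e
      simp only [ZMod.natCast_mod, Nat.cast_add, hs, Nat.cast_sub hij.le] at e'
      exact (h _ _ (inj i j hij hj)).2.1 (by linear_combination e')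
    · have e' := congrArg (Nat.cast : ℕ → ZMod 11) e
      simp only [ZMod.natCast_mod, Nat.cast_add, hs, Nat.cast_sub hij.le] at e'
      exact (h _ _ (inj i j hij hj)).2.2 (by linear_combination -e')
  obtain ⟨m, hm⟩ := hq.exists_linear (by simp)
  refine ⟨m, fun a => ?_⟩
  have e := congrArg (Nat.cast : ℕ → ZMod 11) (hm a.val a.val_lt)
  simp only [ZMod.natCast_mod, Nat.cast_mul, ZMod.natCast_zmod_val] at e
  linear_combination e

/-- The origin and the `2n` vectors `±e_i`. -/
def crossVec {n : ℕ} {R : Type*} [Ring R] : Option (Fin n ⊕ Fin n) → Fin n → R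
  | none => 0
  | some (.inl i) => Pi.single i 1
  | some (.inr i) => -Pi.single i 1

theorem card_crossIndex (n : ℕ) : Fintype.card (Option (Fin n ⊕ Fin n)) = 2 * n + 1 := by
  simp [two_mul]

section Prime

variable {p : ℕ} [Fact p.Prime] {n : ℕ} {S : Set (Fin n → ZMod p)}

theorem existsUnique_add_zmod_smul_mem (hp : p = 2 * n + 1)
    (h : ∀ x, ∃! i, x + crossVec i ∈ S) {a : ZMod p} (ha : a ≠ 0) (x : Fin n → ZMod p) :
    ∃! i, x + a • crossVec i ∈ S := by
  obtain ⟨q, hqp, hq, rfl⟩ := Nat.forall_exists_prime_gt_and_eq_mod ha.isUnit p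
  simpa only [Nat.cast_smul_eq_nsmul] using existsUnique_add_smul_mem h hq (by
    rw [card_crossIndex, ← hp, Nat.prime_dvd_prime_iff_eq hq Fact.out]
    omega) x

/-- Two code words never differ by a multiple of a difference of two vectors of the cross. -/
theorem smul_crossVec_injective (hp : p = 2 * n + 1) (h : ∀ x, ∃! i, x + crossVec i ∈ S)
    {s t : Fin n → ZMod p} (hs : s ∈ S) (ht : t ∈ S) {a : ZMod p} (ha : a ≠ 0)
    {i j : Option (Fin n ⊕ Fin n)} (e : t - s = a • (crossVec j - crossVec i)) : i = j := by
  refine (existsUnique_add_zmod_smul_mem hp h ha (s - a • crossVec i)).unique ?_ ?_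
  · simpa using hs
  · convert ht using 1
    rw [smul_sub] at e
    linear_combination (exp := 1) -e

/-- Every line parallel to a coordinate axis contains exactly one code word. -/
theorem existsUnique_add_single_mem (hp : p = 2 * n + 1) (h : ∀ x, ∃! i, x + crossVec i ∈ S)
    (i : Fin n) (x : Fin n → ZMod p) : ∃! c, x + Pi.single i c ∈ S := by
  classical
  have hdir : ∀ c : ZMod p, Pi.single i c = c • (crossVec (some (.inl i)) : Fin n → ZMod p) := by
    intro c
    simp [crossVec, ← Pi.single_smul']
  have hinj : ∀ s ∈ S, ∀ t ∈ S, ∀ c : ZMod p, t - s = Pi.single i c → c = 0 := by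
    intro s hs t ht c e
    by_contra hc
    have := smul_crossVec_injective hp h hs ht hc (i := none) (j := some (.inl i))
      (by rw [e, hdir]; simp [crossVec])
    simp at this
  let f : S × ZMod p → (Fin n → ZMod p) := fun y => y.1.1 - Pi.single i y.2
  let g : S × Option (Fin n ⊕ Fin n) → (Fin n → ZMod p) := fun y => y.1.1 - crossVec y.2
  have hf : Function.Injective f := by
    rintro ⟨⟨s, hs⟩, c⟩ ⟨⟨t, ht⟩, d⟩ e
    have e' : s - Pi.single i c = t - Pi.single i d := e
    have hd := hinj s hs t ht (d - c) (by
      rw [Pi.single_sub]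
      linear_combination (exp := 1) -e')
    obtain rfl := sub_eq_zero.1 hd
    simpa using e'
  have hg : Function.Bijective g := by
    constructor
    · rintro ⟨⟨s, hs⟩, c⟩ ⟨⟨t, ht⟩, d⟩ e
      have e' : s - crossVec c = t - crossVec d := e
      have hcd := (h (s - crossVec c)).unique (y₁ := c) (y₂ := d) (by simpa using hs)
        (by rw [e']; simpa using ht)
      subst hcd
      simpa using e'
    · intro y
      obtain ⟨c, hc, -⟩ := h y
      exact ⟨(⟨_, hc⟩, c), by simp [g]⟩
  have hbij : Function.Bijective f := by
    rw [Fintype.bijective_iff_injective_and_card]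
    refine ⟨hf, ?_⟩
    rw [← Fintype.card_of_bijective hg, Fintype.card_prod, Fintype.card_prod, card_crossIndex,
      ZMod.card, ← hp]
  obtain ⟨⟨⟨s, hs⟩, c⟩, e⟩ := hbij.2 x
  have e' : s - Pi.single i c = x := e
  refine ⟨c, by rw [← e']; simpa using hs, fun d hd => ?_⟩
  have := hinj s hs _ hd (d - c) (by rw [← e', Pi.single_sub]; abel)
  exact sub_eq_zero.1 this

/-- A function that is affine on all lines parallel to coordinate axes, with nowhere vanishing
slopes, is additive up to a constant. -/
theorem map_add_of_affine_on_lines {g : (Fin n → ZMod p) → ZMod p}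
    {m : Fin n → (Fin n → ZMod p) → ZMod p}
    (hm : ∀ i x a, g (x + Pi.single i a) = g x + a * m i x) (hne : ∀ i x, m i x ≠ 0) (h0 : g 0 = 0)
    (x y : Fin n → ZMod p) : g (x + y) = g x + g y := by
  have hstep : ∀ i k x b, m i (x + Pi.single k b) = m i x := by
    intro i k x b
    have key : ∀ b, m i (x + Pi.single k b) = m i x + b * (m k (x + Pi.single i 1) - m k x) := by
      intro b
      have h1 := hm i (x + Pi.single k b) 1
      have h2 := hm k (x + Pi.single i 1) b
      rw [add_right_comm, h2, hm i x 1, hm k x b] at h1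
      linear_combination -h1
    by_cases hc : m k (x + Pi.single i 1) - m k x = 0
    · rw [key, hc, mul_zero, add_zero]
    · refine absurd (key (-m i x / (m k (x + Pi.single i 1) - m k x))) ?_
      rw [div_mul_cancel₀ _ hc, add_neg_cancel]
      exact hne _ _
  have hall : ∀ y, ∀ i x, m i (x + y) = m i x := by
    intro y
    induction y using Pi.single_induction with
    | zero => simp
    | add f g hf hg => intro i x; rw [← add_assoc, hg, hf]
    | single i a => exact fun k x => hstep k i x a
  have hconst : ∀ i x, m i x = m i 0 := fun i x => by simpa using hall x i 0
  induction y using Pi.single_induction generalizing x with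
  | zero => simp [h0]
  | add f g' hf hg => rw [← add_assoc, hg, hf, hg f, add_assoc]
  | single i a =>
    have h1 := hm i 0 a
    rw [zero_add, h0] at h1
    rw [hm, h1, hconst i x, zero_add]

end Prime

theorem add_neg_mem_of_perfect {S : Set (Fin 5 → ZMod 11)} (h : ∀ x, ∃! i, x + crossVec i ∈ S)
    (h0 : 0 ∈ S) : (∀ x ∈ S, ∀ y ∈ S, x + y ∈ S) ∧ ∀ x ∈ S, -x ∈ S := by
  have : Fact (Nat.Prime 11) := ⟨by norm_num⟩
  have hp : 11 = 2 * 5 + 1 := rfl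
  choose g hg hu using existsUnique_add_single_mem hp h 0
  have hsub : ∀ x c, g (x + Pi.single 0 c) = g x - c := fun x c => by
    refine (hu _ _ ?_).symm
    simpa [add_assoc, ← Pi.single_add] using hg x
  have hmem : ∀ x, x ∈ S ↔ g x = 0 := fun x =>
    ⟨fun hx => (hu x 0 (by simpa using hx)).symm, fun hx => by simpa [hx] using hg x⟩
  have hg0 : g 0 = 0 := (hmem 0).1 h0
  have hline : ∀ i x, ∃ m, m ≠ 0 ∧ ∀ a, g (x + Pi.single i a) = g x + a * m := by
    intro i x
    by_cases hi : i = 0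
    · subst hi
      exact ⟨-1, by simp, fun a => by rw [hsub]; ring⟩
    have hq : ∀ a b : ZMod 11, a ≠ b →
        g (x + Pi.single i a) ≠ g (x + Pi.single i b) ∧
        g (x + Pi.single i a) + a ≠ g (x + Pi.single i b) + b ∧
        g (x + Pi.single i a) - a ≠ g (x + Pi.single i b) - b := by
      intro a b hab
      have hba : b - a ≠ 0 := sub_ne_zero.2 hab.symm
      refine ⟨fun e => ?_, fun e => ?_, fun e => ?_⟩
      · have := smul_crossVec_injective hp h (hg (x + Pi.single i a)) (hg (x + Pi.single i b)) hba
          (i := none) (j := some (.inl i)) (by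
            rw [e]
            simp [crossVec, ← Pi.single_smul', Pi.single_sub])
        simp at this
      · have e' : g (x + Pi.single i b) = g (x + Pi.single i a) + -(b - a) := by
          linear_combination -e
        have := smul_crossVec_injective hp h (hg (x + Pi.single i a)) (hg (x + Pi.single i b)) hba
          (i := some (.inl 0)) (j := some (.inl i)) (by
            rw [e']
            simp only [crossVec, smul_sub, ← Pi.single_smul', smul_eq_mul, mul_one, Pi.single_sub,
              Pi.single_add, Pi.single_neg]
            abel)
        simp at this
        exact hi this.symm
      · have e' : g (x + Pi.single i b) = g (x + Pi.single i a) + (b - a) := by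
          linear_combination -e
        have := smul_crossVec_injective hp h (hg (x + Pi.single i a)) (hg (x + Pi.single i b)) hba
          (i := some (.inr 0)) (j := some (.inl i)) (by
            rw [e']
            simp only [crossVec, smul_sub, smul_neg, ← Pi.single_smul', smul_eq_mul, mul_one,
              Pi.single_sub, Pi.single_add]
            abel)
        simp at this
    obtain ⟨m, hm⟩ := exists_affine_of_queens _ hq
    simp only [Pi.single_zero, add_zero] at hm
    refine ⟨m, ?_, hm⟩
    rintro rfl
    refine (hq 0 1 zero_ne_one).1 ?_
    rw [hm 0, hm 1, mul_zero, mul_zero]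
  choose m hne hm using hline
  have hadd := map_add_of_affine_on_lines hm hne hg0
  refine ⟨fun x hx y hy => ?_, fun x hx => ?_⟩
  · rw [hmem] at *
    rw [hadd, hx, hy, add_zero]
  · rw [hmem] at *
    have := hadd x (-x)
    rwa [add_neg_cancel, hg0, hx, zero_add, eq_comm] at this

section Integer

variable {n : ℕ}

theorem exists_crossVec_eq_neg {R : Type*} [Ring R] (i : Option (Fin n ⊕ Fin n)) :
    ∃ j, (crossVec j : Fin n → R) = -crossVec i := by
  rcases i with _ | i | i
  · exact ⟨none, by simp [crossVec]⟩
  · exact ⟨some (.inr i), rfl⟩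
  · exact ⟨some (.inl i), by simp [crossVec]⟩

theorem comp_crossVec {R R' : Type*} [Ring R] [Ring R'] (f : R →+* R')
    (i : Option (Fin n ⊕ Fin n)) (k : Fin n) : f ((crossVec i : Fin n → R) k) = crossVec i k := by
  rcases i with _ | i | i <;> simp [crossVec, Pi.single_apply, apply_ite f]

theorem crossVec_injective : Function.Injective (crossVec : _ → Fin n → ℤ) := by
  have hsingle : ∀ i j : Fin n, (Pi.single i 1 : Fin n → ℤ) = Pi.single j 1 → i = j := by
    intro i j e
    have := congrFun e i
    rw [Pi.single_eq_same, Pi.single_apply] at this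
    by_contra hij
    simp [hij] at this
  have hne : ∀ i j : Fin n, (Pi.single i 1 : Fin n → ℤ) ≠ -Pi.single j 1 := by
    intro i j e
    have := congrFun e i
    rw [Pi.neg_apply, Pi.single_eq_same, Pi.single_apply] at this
    split_ifs at this <;> omega
  rintro (_ | i | i) (_ | j | j) e
  all_goals simp only [crossVec] at e
  · rfl
  · simp [eq_comm] at e
  · simp [eq_comm] at e
  · simp at e
  · rw [hsingle i j e]
  · exact absurd e (hne i j)
  · simp at e
  · exact absurd e.symm (hne j i)
  · rw [hsingle i j (neg_injective e)]

theorem mem_cross_iff {u x : Fin n → ℝ} : x ∈ cross u ↔ ∃ i, x ∈ unitCube (u + crossVec i) := by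
  simp [cross, crossVec, Option.exists, Sum.exists, ← exists_or, ← sub_eq_add_neg]

theorem self_mem_interior_unitCube (c : Fin n → ℝ) : c ∈ interior (unitCube c) := by
  rw [mem_interior_iff_mem_nhds, Metric.mem_nhds_iff]
  refine ⟨1 / 2, by norm_num, fun x hx k => ?_⟩
  rw [← Real.dist_eq]
  exact (dist_le_pi_dist x c k).trans (Metric.mem_ball.1 hx).le

theorem IsZTiling.existsUnique_add_crossVec_mem {T : Set (Fin n → ℤ)} (hT : IsZTiling T)
    (z : Fin n → ℤ) : ∃! i, z + crossVec i ∈ T := by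
  have hcast : ∀ i k, (((crossVec i : Fin n → ℤ) k : ℤ) : ℝ) = (crossVec i : Fin n → ℝ) k :=
    fun i k => comp_crossVec (Int.castRingHom ℝ) i k
  obtain ⟨hcover, hdisj⟩ := hT
  refine existsUnique_of_exists_of_unique ?_ fun i j hi hj => ?_
  · have hz : (fun k => (z k : ℝ)) ∈ (Set.univ : Set (Fin n → ℝ)) := Set.mem_univ _
    rw [← hcover] at hz
    simp only [Set.mem_iUnion, Set.mem_image, exists_prop, exists_exists_and_eq_and,
      mem_cross_iff] at hz
    obtain ⟨t, ht, i, hi⟩ := hz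
    obtain ⟨j, hj⟩ := exists_crossVec_eq_neg (R := ℤ) i
    refine ⟨j, ?_⟩
    convert ht using 1
    ext k
    have hk := hi k
    rw [Pi.add_apply, ← hcast] at hk
    have hk' : |z k - (t k + crossVec i k)| < 1 := by
      have : (|z k - (t k + (crossVec i : Fin n → ℤ) k)| : ℝ) < 1 :=
        lt_of_le_of_lt hk one_half_lt_one
      exact_mod_cast this
    rw [Int.abs_lt_one_iff] at hk'
    rw [hj, Pi.add_apply, Pi.neg_apply]
    linarith
  · by_contra hij
    have hint : ∀ i, (fun k => (z k : ℝ)) ∈ interior (cross fun k => (((z + crossVec i : Fin n → ℤ) k : ℤ) : ℝ)) := by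
      intro i
      obtain ⟨j, hj⟩ := exists_crossVec_eq_neg (R := ℤ) i
      refine interior_mono (fun x hx => mem_cross_iff.2 ⟨j, ?_⟩) (self_mem_interior_unitCube _)
      convert hx using 2
      ext k
      rw [Pi.add_apply, ← hcast, hj]
      simp
    refine Set.disjoint_left.1 (hdisj _ ⟨_, hi, rfl⟩ _ ⟨_, hj, rfl⟩ fun e => hij ?_) (hint i) (hint j)
    apply crossVec_injective
    ext k
    have := congrFun e k
    simpa using this

theorem add_prime_smul_mem_iff {T : Set (Fin n → ℤ)} (h : ∀ z, ∃! i, z + crossVec i ∈ T)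
    (hp : (2 * n + 1).Prime) (x y : Fin n → ℤ) : x + (2 * n + 1) • y ∈ T ↔ x ∈ T := by
  have hstep : ∀ i x, x + (2 * n + 1) • crossVec i ∈ T ↔ x ∈ T := by
    intro i x
    have := add_smul_mem_iff h (by rwa [card_crossIndex]) x i none
    rw [card_crossIndex] at this
    simpa [crossVec] using this
  induction y using Pi.single_induction generalizing x with
  | zero => simp
  | add f g hf hg => rw [smul_add, ← add_assoc]; exact (hg _).trans (hf x)
  | single i m =>
    induction m using Int.induction_on generalizing x with
    | zero => simp
    | succ m hm =>
      rw [Pi.single_add, smul_add, ← add_assoc]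
      exact (hstep (some (.inl i)) _).trans (hm x)
    | pred m hm =>
      rw [Pi.single_sub, sub_eq_add_neg, smul_add, ← add_assoc]
      exact (hstep (some (.inr i)) _).trans (hm x)

/-- The centres of a `Z`-tiling of `ℝ⁵` by crosses form a lattice. -/
theorem IsZTiling.add_neg_mem {T : Set (Fin 5 → ℤ)} (hT : IsZTiling T) (h0 : 0 ∈ T) :
    (∀ x ∈ T, ∀ y ∈ T, x + y ∈ T) ∧ ∀ x ∈ T, -x ∈ T := by
  have h := hT.existsUnique_add_crossVec_mem
  let π : (Fin 5 → ℤ) →+ (Fin 5 → ZMod 11) := (Int.castAddHom (ZMod 11)).compLeft (Fin 5)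
  have hπ : ∀ z, z ∈ T ↔ π z ∈ π '' T := by
    refine fun z => ⟨Set.mem_image_of_mem π, ?_⟩
    rintro ⟨t, ht, e⟩
    have hdvd : ∀ k, (11 : ℤ) ∣ z k - t k := by
      intro k
      exact (ZMod.intCast_eq_intCast_iff_dvd_sub _ _ 11).1 (congrFun e k)
    choose y hy using hdvd
    have : z = t + (2 * 5 + 1) • y := by
      ext k
      simp [← hy]
    rwa [this, add_prime_smul_mem_iff h (by norm_num)]
  have hsurj : Function.Surjective π := fun x =>
    ⟨fun k => (x k).val, by ext k; simp [π]⟩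
  have hperfect : ∀ x, ∃! i, x + crossVec i ∈ π '' T := by
    intro x
    obtain ⟨z, rfl⟩ := hsurj x
    have hc : ∀ i, (crossVec i : Fin 5 → ZMod 11) = π (crossVec i) := fun i => by
      ext k
      exact (comp_crossVec (Int.castRingHom (ZMod 11)) i k).symm
    simpa only [hc, ← map_add, ← hπ] using h z
  obtain ⟨hadd, hneg⟩ := add_neg_mem_of_perfect hperfect ⟨0, h0, map_zero π⟩
  refine ⟨fun x hx y hy => ?_, fun x hx => ?_⟩
  · rw [hπ, map_add]
    exact hadd _ ((hπ x).1 hx) _ ((hπ y).1 hy)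
  · rw [hπ, map_neg]
    exact hneg _ ((hπ x).1 hx)

end Integer

theorem translatedNeighborhood_eq {n : ℕ} {T : Set (Fin n → ℤ)}
    (hadd : ∀ x ∈ T, ∀ y ∈ T, x + y ∈ T) (hneg : ∀ x ∈ T, -x ∈ T) (k : ℕ) {W : Fin n → ℤ}
    (hW : W ∈ T) : translatedNeighborhood T k W = neighborhood T k 0 := by
  ext V
  simp only [translatedNeighborhood, neighborhood, manhattanDist, Set.mem_image, Set.mem_ofPred_eq]
  constructor
  · rintro ⟨U, ⟨hU, hd⟩, rfl⟩
    refine ⟨by rw [sub_eq_add_neg]; exact hadd _ hU _ (hneg _ hW), ?_⟩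
    simpa using hd
  · rintro ⟨hV, hd⟩
    refine ⟨V + W, ⟨hadd _ hV _ hW, ?_⟩, by simp⟩
    simpa using hd

theorem neg_mem_neighborhood {n : ℕ} {T : Set (Fin n → ℤ)} (hneg : ∀ x ∈ T, -x ∈ T) (k : ℕ)
    {V : Fin n → ℤ} (hV : V ∈ neighborhood T k 0) : -V ∈ neighborhood T k 0 :=
  ⟨hneg _ hV.1, by simpa [manhattanDist] using hV.2⟩

end CrossTiling

theorem mainTheorem6 (T : Set (Fin 5 → ℤ)) (hT : CrossTiling.IsZTiling T) (hO : 0 ∈ T) :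
    ((∀ W ∈ T, CrossTiling.translatedNeighborhood T 5 W = CrossTiling.neighborhood T 5 0) ∧
      (∀ V ∈ CrossTiling.neighborhood T 5 0, -V ∈ CrossTiling.neighborhood T 5 0)) ∧
    ((∀ W ∈ T, CrossTiling.translatedNeighborhood T 3 W = CrossTiling.neighborhood T 3 0) ∧
      (∀ V ∈ CrossTiling.neighborhood T 3 0, -V ∈ CrossTiling.neighborhood T 3 0)) := by
  obtain ⟨hadd, hneg⟩ := hT.add_neg_mem hO
  exact ⟨⟨fun _ hW => CrossTiling.translatedNeighborhood_eq hadd hneg 5 hW,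
    fun _ hV => CrossTiling.neg_mem_neighborhood hneg 5 hV⟩,
    fun _ hW => CrossTiling.translatedNeighborhood_eq hadd hneg 3 hW,
    fun _ hV => CrossTiling.neg_mem_neighborhood hneg 3 hV⟩
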